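/- A \emph{game graph} $G$ consists of a finite directed graph without self-loops in which every node has at least one successor, a labeling of every node $v$ by a positive natural number $\pi(v)$ (its priority), and a partition of the nodes into nodes owned by Even ($E$) and nodes owned by Odd ($O$). A (partial) play is an infinite (nonempty finite) path. A strategy of a player $P$ maps every partial play ending in a node of $P$ to a successor of that node. A play is winning for Even (Odd) if the maximal priority seen infinitely often is even (odd). $\mathit{Win}_P(G)$ is the set of nodes $v$ from which $P$ has a strategy such that every play that starts in $v$ and agrees with it is winning for $P$. A \emph{dominion} for $P$ is a set $S$ of nodes such that from every $v\in S$ player $P$ has a strategy for which every play from $v$ that agrees with it is winning for $P$ and uses only nodes of $S$. The attractor $\mathrm{Atr}_P(G,N)$ of a set $N$ of nodes is the smallest set $A\supseteq N$ of nodes that contains every node of $P$ having some successor in $A$ and every node of the opponent all of whose successors are in $A$; $G\setminus A$ denotes $G$ with the nodes of $A$ and all their incident edges removed. The procedure $\mathrm{Solve}_E(G,h,p_E,p_O)$ is the following. If $G=\emptyset$ or $p_E\le 1$, return $\emptyset$. Otherwise let $B(r)$ be the block of instructions $$N_h:=\{v\in\mathrm{nodes}(G)\mid\pi(v)=h\};\quad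 H:=G\setminus\mathrm{Atr}_E(G,N_h);\quad W_O:=\mathrm{Solve}_O(H,h-1,r,p_E);\quad G:=G\setminus\mathrm{Atr}_O(G,W_O).$$ (1) Do $B(\lfloor p_O/2\rfloor)$, repeating it as long as $W_O\neq\emptyset$ after its execution; (2) do $B(p_O)$ once; (3) while $W_O\ne\emptyset$, do $B(\lfloor p_O/2\rfloor)$. Then return $\mathrm{nodes}(G)$. The procedure $\mathrm{Solve}_O(G,h,p_O,p_E)$ is obtained by exchanging the roles of $E$ and $O$. \textbf{Statement.} Let $G$ be a game graph with $n$ nodes, and let $h$ be an even number that is greater than or equal to all priorities in $G$. Then the call $\mathrm{Solve}_E(G,h,n,n)$ terminates and returns exactly $\mathit{Win}_E(G)$. Moreover, $\mathit{Win}_E(G)$ is a dominion for Even, $\mathit{Win}_O(G)$ is a dominion for Odd, and $\mathit{Win}_E(G)$ and $\mathit{Win}_O(G)$ form a partition of the nodes of $G$ (they are disjoint and their union is the set of all nodes). -/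

import Mathlib

/-- The two players. -/
inductive Player where
  | even : Player
  | odd : Player

/-- The opponent of a player. -/
def Player.opp : Player → Player
  | .even => .odd
  | .odd => .even

/-- The priorities that are good for a player. -/
def Player.Likes : Player → ℕ → Prop
  | .even, p => Even p
  | .odd, p => Odd p

/-- A game graph whose nodes are elements of `V`: a directed graph without dead ends and without
self-loops, with positive priorities on the nodes, every node being owned by one of the players.
The values of `owner` and `prio` outside `nodes` are irrelevant. -/
structure GameGraph (V : Type*) where
  nodes : Set V
  edge : V → V → Prop
  owner : V → Player
  prio : V → ℕ
  edge_mem : ∀ u v, edge u v → u ∈ nodes ∧ v ∈ nodes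
  exists_succ : ∀ v ∈ nodes, ∃ w, edge v w
  no_loop : ∀ v, ¬ edge v v
  prio_pos : ∀ v ∈ nodes, 0 < prio v

namespace GameGraph

variable {V : Type*}

/-! ### Plays, strategies, winning regions, dominions -/

/-- A play: an infinite path. -/
def IsPlay (G : GameGraph V) (ρ : ℕ → V) : Prop :=
  ∀ i, G.edge (ρ i) (ρ (i + 1))

/-- A partial play: a nonempty finite path. -/
def IsPartialPlay (G : GameGraph V) (l : List V) : Prop :=
  l ≠ [] ∧ (∀ v ∈ l, v ∈ G.nodes) ∧ l.IsChain G.edge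

/-- A strategy of `P` maps every partial play ending in a node of `P` to a successor of that node
(the values on other lists are irrelevant). -/
def IsStrategy (G : GameGraph V) (P : Player) (σ : List V → V) : Prop :=
  ∀ (l : List V) (v : V), G.IsPartialPlay l → l.getLast? = some v → G.owner v = P →
    G.edge v (σ l)

/-- The play `ρ` agrees with the strategy `σ` of `P`: whenever the current node `ρ i` belongs
to `P`, the next node is chosen by `σ` from the history `ρ 0, …, ρ i`. -/
def Agrees (G : GameGraph V) (P : Player) (σ : List V → V) (ρ : ℕ → V) : Prop :=
  ∀ i, G.owner (ρ i) = P → ρ (i + 1) = σ ((List.range (i + 1)).map ρ)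

/-- The parity condition of `P`: the largest priority that is seen infinitely often is
even (for Even), respectively odd (for Odd). -/
def limsupCond (G : GameGraph V) (P : Player) : Set (ℕ → V) :=
  {ρ | ∃ p, IsGreatest {q | ∃ᶠ i in Filter.atTop, G.prio (ρ i) = q} p ∧ P.Likes p}

/-- The sequences that use only nodes from `S`. -/
def safety (S : Set V) : Set (ℕ → V) :=
  {ρ | ∀ i, ρ i ∈ S}

/-- `P` has a winning strategy from the node `v` for the winning condition `C`. -/
def WinsFrom (G : GameGraph V) (P : Player) (C : Set (ℕ → V)) (v : V) : Prop :=
  v ∈ G.nodes ∧ ∃ σ : List V → V, G.IsStrategy P σ ∧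
    ∀ ρ : ℕ → V, G.IsPlay ρ → ρ 0 = v → G.Agrees P σ ρ → ρ ∈ C

/-- The winning region of `P` in the parity game. -/
def win (G : GameGraph V) (P : Player) : Set V :=
  {v | G.WinsFrom P (G.limsupCond P) v}

/-- `S` is a dominion for `P`: from every node of `S`, player `P` can win the parity game without
leaving `S`. -/
def IsDominion (G : GameGraph V) (P : Player) (S : Set V) : Prop :=
  S ⊆ G.nodes ∧ ∀ v ∈ S, G.WinsFrom P (G.limsupCond P ∩ safety S) v

/-! ### Attractors and subgames -/

/-- The attractor of (the nodes of `G` in) `N` for `P`, as the least set closed under the rules. -/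
inductive Attr (G : GameGraph V) (P : Player) (N : Set V) : V → Prop
  | base (v : V) (hv : v ∈ G.nodes) (hN : v ∈ N) : Attr G P N v
  | own (v w : V) (hP : G.owner v = P) (he : G.edge v w) (hw : Attr G P N w) : Attr G P N v
  | opp (v : V) (hv : v ∈ G.nodes) (hP : G.owner v ≠ P)
      (hall : ∀ w, G.edge v w → Attr G P N w) : Attr G P N v

/-- The game graph obtained from `G` by removing the attractor of `N` for `P`. -/
def removeAttr (G : GameGraph V) (P : Player) (N : Set V) : GameGraph V where
  nodes := {v | v ∈ G.nodes ∧ ¬ G.Attr P N v}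
  edge u v := G.edge u v ∧ ¬ G.Attr P N u ∧ ¬ G.Attr P N v
  owner := G.owner
  prio := G.prio
  edge_mem u v h :=
    ⟨⟨(G.edge_mem u v h.1).1, h.2.1⟩, ⟨(G.edge_mem u v h.1).2, h.2.2⟩⟩
  exists_succ := by
    rintro v ⟨hv, hA⟩
    by_contra hno
    have hall : ∀ w, G.edge v w → G.Attr P N w := by
      intro w hw
      by_contra hw'
      exact hno ⟨w, hw, hA, hw'⟩
    by_cases hP : G.owner v = P
    · obtain ⟨w, hw⟩ := G.exists_succ v hv
      exact hA (Attr.own v w hP hw (hall w hw))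
    · exact hA (Attr.opp v hv hP hall)
  no_loop v h := G.no_loop v h.1
  prio_pos v hv := G.prio_pos v hv.1

/-- The nodes of priority `h`. -/
def prioNodes (G : GameGraph V) (h : ℕ) : Set V :=
  {v | v ∈ G.nodes ∧ G.prio v = h}

/-! ### The recursive procedure

The execution of the procedures is described by a big-step semantics. -/

/-- One pass through the block

* `N := {v ∈ nodes(G) | π(v) = h}`;
* `H := G ∖ Atr_P(G, N)`;
* `W := call(H)`;
* `G := G ∖ Atr_{opp P}(G, W)`

of the procedure of player `P`, where `call H W` means that the recursive call on `H` returns `W`.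
It starts with the value `G` of the game variable and ends with the values `W` and `G'`. -/
def Block (P : Player) (h : ℕ) (call : GameGraph V → Set V → Prop)
    (G : GameGraph V) (W : Set V) (G' : GameGraph V) : Prop :=
  call (G.removeAttr P (G.prioNodes h)) W ∧ G' = G.removeAttr P.opp W

/-- The loop `while W ≠ ∅ do block`, started with the values `W` and `G`, terminates with the
value `G'` of the game variable. -/
inductive WhileLoop (P : Player) (h : ℕ) (call : GameGraph V → Set V → Prop) :
    Set V → GameGraph V → GameGraph V → Prop
  | done (G : GameGraph V) : WhileLoop P h call ∅ G G
  | iter (W W₁ : Set V) (G G₁ G' : GameGraph V) (hW : W ≠ ∅) (hB : Block P h call G W₁ G₁)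
      (hL : WhileLoop P h call W₁ G₁ G') : WhileLoop P h call W G G'

/-- `SolveReturns h P G p q W`: the call `Solve_P(G, h, p, q)` terminates and returns `W`, where
`p` is the precision parameter of `P` and `q` is that of the opponent of `P`.

* If `G` is empty or `p ≤ 1`, then `∅` is returned.
* Otherwise there are three stages: a loop `do block while W ≠ ∅` with recursive calls
  `Solve_{opp P}(H, h - 1, ⌊q / 2⌋, p)`; the block executed once with the recursive call
  `Solve_{opp P}(H, h - 1, q, p)`; a loop `while W ≠ ∅ do block` with recursive calls
  `Solve_{opp P}(H, h - 1, ⌊q / 2⌋, p)`. Then the set of remaining nodes is returned.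

As `h` bounds the priorities in `G`, and priorities are positive, the second case needs no clause
for `h = 0`. -/
def SolveReturns : ℕ → Player → GameGraph V → ℕ → ℕ → Set V → Prop
  | 0, _, G, p, _, W => (G.nodes = ∅ ∨ p ≤ 1) ∧ W = ∅
  | h + 1, P, G, p, q, W =>
      ((G.nodes = ∅ ∨ p ≤ 1) ∧ W = ∅) ∨
      (¬ (G.nodes = ∅ ∨ p ≤ 1) ∧
        ∃ (W₁ W₂ : Set V) (G₁ G₂ G₃ G₄ : GameGraph V),
          (Block P (h + 1) (fun H U => SolveReturns h P.opp H (q / 2) p U) G W₁ G₁ ∧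
            WhileLoop P (h + 1) (fun H U => SolveReturns h P.opp H (q / 2) p U) W₁ G₁ G₂) ∧
          Block P (h + 1) (fun H U => SolveReturns h P.opp H q p U) G₂ W₂ G₃ ∧
          WhileLoop P (h + 1) (fun H U => SolveReturns h P.opp H (q / 2) p U) W₂ G₃ G₄ ∧
          W = G₄.nodes)

end GameGraph

/-!
The heart of the proof is that parity games are won with positional strategies. A *positional
dominion* (`IsPosDom`) is a set on which a player wins with one positional strategy and without
leaving it.

Positional determinacy (`exists_isPosDom_union`) is proved by induction on a bound `h` for the
priorities. Let `P` be the player who likes `h`, and take a maximal positional dominion of the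
opponent. It is closed under attraction, and the game that remains after its removal has no nonempty
positional dominion of the opponent (`eq_empty_of_maximal`). By induction `P` therefore wins
everywhere outside the attractor of the nodes of priority `h`, and hence wins the whole remaining
game: visit priority `h` infinitely often, or eventually stay where the inductive strategy wins
(`isPosDom_nodes_of_removeAttr`). As both players cannot win from the same node (`disjoint_win`),
the winning regions are positional dominions and partition the nodes.

A call with precisions `p` and `q` returns a set that contains all positional dominions of `P` with
at most `p` nodes and is disjoint from those of the opponent with at most `q` nodes
(`SolveReturns.approximates`). The first part holds because a small dominion of `P` survives every
block. For the second part, a nonempty dominion of the opponent contains one without the top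
priority (`IsPosDom.exists_subset_avoiding`), which is visible to the recursive call. When the first
loop ends, each such dominion has more than `q / 2` nodes, so the block with full precision removes
more than half of the allowed size, and what is left is small enough for the second loop. With
`p = q` equal to the number of nodes both winning regions are within the precision, so the result is
the winning region. Calls terminate because every block that finds something removes nodes
(`exists_whileLoop`).
-/

namespace GameGraph

variable {V : Type*}

/-! ### Players and tails of plays -/

theorem _root_.Player.opp_opp (P : Player) : P.opp.opp = P := by cases P <;> rfl

theorem _root_.Player.ne_iff_eq_opp {P Q : Player} : Q ≠ P ↔ Q = P.opp := by
  cases P <;> cases Q <;> simp [Player.opp]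

theorem _root_.Player.Likes.not_opp {P : Player} {k : ℕ} (hk : P.Likes k) : ¬ P.opp.Likes k := by
  cases P
  · exact fun h => Nat.not_odd_iff_even.2 hk h
  · exact fun h => Nat.not_odd_iff_even.2 h hk

theorem _root_.Player.Likes.pred {P : Player} {k : ℕ} (hk : P.Likes (k + 1)) : P.opp.Likes k := by
  cases P
  · exact Nat.not_even_iff_odd.1 fun h => Nat.even_add_one.1 hk h
  · exact Nat.not_odd_iff_even.1 fun h => Nat.odd_add_one.1 hk h

theorem limsupCond_of_tail {G : GameGraph V} {P : Player} {ρ : ℕ → V} (k : ℕ)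
    (h : (fun i => ρ (i + k)) ∈ G.limsupCond P) : ρ ∈ G.limsupCond P := by
  have key : ∀ q, (∃ᶠ i in Filter.atTop, G.prio (ρ (i + k)) = q) ↔
      ∃ᶠ i in Filter.atTop, G.prio (ρ i) = q := fun q => by
    conv_rhs => rw [← Filter.map_add_atTop_eq_nat k, Filter.frequently_map]
  simpa only [limsupCond, Set.mem_ofPred_eq, key] using h

theorem isGreatest_of_frequently {G : GameGraph V} {h : ℕ} {ρ : ℕ → V}
    (hub : ∀ i, G.prio (ρ i) ≤ h) (hf : ∃ᶠ i in Filter.atTop, G.prio (ρ i) = h) :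
    IsGreatest {q | ∃ᶠ i in Filter.atTop, G.prio (ρ i) = q} h := by
  refine ⟨hf, fun q hq => ?_⟩
  obtain ⟨i, hi⟩ := Filter.Frequently.exists hq
  exact hi ▸ hub i

theorem limsupCond_disjoint (G : GameGraph V) {P : Player} {ρ : ℕ → V}
    (h₁ : ρ ∈ G.limsupCond P) (h₂ : ρ ∈ G.limsupCond P.opp) : False := by
  obtain ⟨p, hp, hpP⟩ := h₁
  obtain ⟨q, hq, hqP⟩ := h₂
  exact hpP.not_opp (hp.unique hq ▸ hqP)

/-! ### Positional dominions -/

/-- The moves that remain in `G` when `P` plays according to the positional strategy `τ`. -/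
def Step (G : GameGraph V) (P : Player) (τ : V → V) (v w : V) : Prop :=
  G.edge v w ∧ (G.owner v = P → w = τ v)

/-- A dominion of `P` on which `P` wins with a single positional strategy: all moves that agree
with the strategy stay in `S`, and all plays in `S` that agree with it are won by `P`. -/
def IsPosDom (G : GameGraph V) (P : Player) (S : Set V) : Prop :=
  S ⊆ G.nodes ∧ ∃ τ : V → V,
    (∀ v ∈ S, G.owner v = P → G.edge v (τ v)) ∧
    (∀ v ∈ S, ∀ w, G.Step P τ v w → w ∈ S) ∧
    ∀ ρ : ℕ → V, (∀ i, ρ i ∈ S) → (∀ i, G.Step P τ (ρ i) (ρ (i + 1))) → ρ ∈ G.limsupCond P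

theorem isPosDom_empty (G : GameGraph V) (P : Player) : G.IsPosDom P ∅ :=
  ⟨Set.empty_subset _, id, by simp, by simp, fun _ h _ => (h 0).elim⟩

theorem exists_step {G : GameGraph V} {P : Player} {τ : V → V} {v : V} (hv : v ∈ G.nodes)
    (hτ : G.owner v = P → G.edge v (τ v)) : ∃ w, G.Step P τ v w := by
  by_cases h : G.owner v = P
  · exact ⟨τ v, hτ h, fun _ => rfl⟩
  · obtain ⟨w, hw⟩ := G.exists_succ v hv
    exact ⟨w, hw, fun h' => (h h').elim⟩

theorem forall_mem_of_step {G : GameGraph V} {P : Player} {τ : V → V} {S : Set V}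
    (hS : ∀ v ∈ S, ∀ w, G.Step P τ v w → w ∈ S) {ρ : ℕ → V} (h0 : ρ 0 ∈ S)
    (hρ : ∀ i, G.Step P τ (ρ i) (ρ (i + 1))) (i : ℕ) : ρ i ∈ S := by
  induction i with
  | zero => exact h0
  | succ i ih => exact hS _ ih _ (hρ i)

/-- A nonempty dominion has at least two nodes, because there are no self-loops. -/
theorem IsPosDom.eq_empty_of_ncard_le_one {G : GameGraph V} {P : Player} {S : Set V}
    (hfin : G.nodes.Finite) (h : G.IsPosDom P S) (hc : S.ncard ≤ 1) : S = ∅ := by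
  by_contra hne
  obtain ⟨v, hv⟩ := Set.nonempty_iff_ne_empty.2 hne
  obtain ⟨hsub, τ, hτ, hcl, -⟩ := h
  obtain ⟨w, hw⟩ := exists_step (hsub hv) (hτ v hv)
  have := (Set.ncard_le_one (hfin.subset hsub)).1 hc v hv w (hcl v hv w hw)
  exact G.no_loop v (this ▸ hw.1 : G.edge v v)

/-- A dominion `S` can be extended by a set `T` on which the plays that agree with a positional
strategy either reach `S` or are won inside `T`. -/
theorem IsPosDom.union {G : GameGraph V} {P : Player} {S T : Set V} (hS : G.IsPosDom P S)
    (hT : T ⊆ G.nodes) (τ : V → V)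
    (hedge : ∀ v ∈ T, v ∉ S → G.owner v = P → G.edge v (τ v))
    (hcl : ∀ v ∈ T, v ∉ S → ∀ w, G.Step P τ v w → w ∈ S ∪ T)
    (hwin : ∀ ρ : ℕ → V, (∀ i, ρ i ∈ T ∧ ρ i ∉ S) → (∀ i, G.Step P τ (ρ i) (ρ (i + 1))) →
      ρ ∈ G.limsupCond P) :
    G.IsPosDom P (S ∪ T) := by
  classical
  obtain ⟨hsub, τS, hSe, hSc, hSw⟩ := hS
  have hin : ∀ {v w}, v ∈ S → G.Step P (S.piecewise τS τ) v w → G.Step P τS v w := by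
    intro v w hv h
    simpa [Step, hv] using h
  have hout : ∀ {v w}, v ∉ S → G.Step P (S.piecewise τS τ) v w → G.Step P τ v w := by
    intro v w hv h
    simpa [Step, hv] using h
  refine ⟨Set.union_subset hsub hT, S.piecewise τS τ, ?_, ?_, ?_⟩
  · intro v hv hP
    by_cases hvS : v ∈ S
    · simpa [hvS] using hSe v hvS hP
    · simpa [hvS] using hedge v (hv.resolve_left hvS) hvS hP
  · intro v hv w hw
    by_cases hvS : v ∈ S
    · exact Or.inl (hSc v hvS w (hin hvS hw))
    · exact hcl v (hv.resolve_left hvS) hvS w (hout hvS hw)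
  · intro ρ hρ hst
    by_cases hk : ∃ k, ρ k ∈ S
    · obtain ⟨k, hk⟩ := hk
      have hmem : ∀ i, ρ (i + k) ∈ S := by
        intro i
        induction i with
        | zero => simpa using hk
        | succ i ih =>
          have := hSc _ ih _ (hin ih (hst (i + k)))
          rwa [show i + 1 + k = i + k + 1 by omega]
      refine limsupCond_of_tail k (hSw _ hmem fun i => ?_)
      have := hin (hmem i) (hst (i + k))
      rwa [show i + 1 + k = i + k + 1 by omega]
    · push Not at hk
      exact hwin ρ (fun i => ⟨(hρ i).resolve_left (hk i), hk i⟩) fun i => hout (hk i) (hst i)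

/-- A positional dominion is a dominion: the positional strategy, continued arbitrarily outside
`S`, reads only the last node of the history. -/
theorem IsPosDom.isDominion {G : GameGraph V} {P : Player} {S : Set V} (h : G.IsPosDom P S) :
    G.IsDominion P S := by
  obtain ⟨hsub, τ, hτ, hcl, hwin⟩ := h
  refine ⟨hsub, fun v hv => ⟨hsub hv, ?_⟩⟩
  have hτ' : ∀ u, ∃ w, (u ∈ S → w = τ u) ∧ (u ∈ G.nodes → G.owner u = P → G.edge u w) := by
    intro u
    by_cases hu : u ∈ S
    · exact ⟨τ u, fun _ => rfl, fun _ => hτ u hu⟩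
    · by_cases hn : u ∈ G.nodes
      · obtain ⟨w, hw⟩ := G.exists_succ u hn
        exact ⟨w, fun h => (hu h).elim, fun _ _ => hw⟩
      · exact ⟨u, fun h => (hu h).elim, fun h => (hn h).elim⟩
  choose τ' hτS hτe using hτ'
  refine ⟨fun l => (l.getLast?.map τ').getD v, ?_, ?_⟩
  · intro l u hl hu hP
    simpa [hu] using hτe u (hl.2.1 u (List.mem_of_getLast? hu)) hP
  · intro ρ hplay h0 hag
    have hnext : ∀ i, G.owner (ρ i) = P → ρ (i + 1) = τ' (ρ i) := by
      intro i hi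
      have := hag i hi
      simpa [List.range_succ] using this
    have hmem : ∀ i, ρ i ∈ S := by
      intro i
      induction i with
      | zero => exact h0 ▸ hv
      | succ i ih =>
        exact hcl _ ih _ ⟨hplay i, fun hP => (hnext i hP).trans (hτS _ ih)⟩
    exact ⟨hwin ρ hmem fun i => ⟨hplay i, fun hP => (hnext i hP).trans (hτS _ (hmem i))⟩, hmem⟩

/-! ### Attractors and dominions -/

theorem Attr.mem_nodes {G : GameGraph V} {P : Player} {N : Set V} {v : V} (h : G.Attr P N v) :
    v ∈ G.nodes := by
  cases h with
  | base _ hv _ => exact hv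
  | own _ w _ he _ => exact (G.edge_mem _ _ he).1
  | opp _ hv _ _ => exact hv

theorem not_attr_empty {G : GameGraph V} {P : Player} {v : V} : ¬ G.Attr P ∅ v := by
  intro h
  induction h with
  | base _ _ hN => exact hN
  | own _ _ _ _ _ ih => exact ih
  | opp v hv _ _ ih =>
    obtain ⟨w, hw⟩ := G.exists_succ v hv
    exact ih w hw

theorem removeAttr_empty (G : GameGraph V) (P : Player) : G.removeAttr P ∅ = G := by
  cases G
  simp [removeAttr, not_attr_empty]

/-- A dominion of `P` that is disjoint from `X` is disjoint from the attractor of `X` for the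
opponent. -/
theorem IsPosDom.not_attr {G : GameGraph V} {P : Player} {S X : Set V} (h : G.IsPosDom P S)
    (hX : Disjoint S X) {v : V} (hv : v ∈ S) : ¬ G.Attr P.opp X v := by
  obtain ⟨hsub, τ, hτ, hcl, -⟩ := h
  intro hA
  induction hA with
  | base v _ hN => exact Set.disjoint_left.1 hX hv hN
  | own v w hP he _ ih =>
    exact ih (hcl v hv w ⟨he, fun h => (Player.ne_iff_eq_opp.2 hP h).elim⟩)
  | opp v hn hP _ ih =>
    have hP' : G.owner v = P := by
      rw [← P.opp_opp]; exact Player.ne_iff_eq_opp.1 hP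
    exact ih _ (hτ v hv hP') (hcl v hv _ ⟨hτ v hv hP', fun _ => rfl⟩)

theorem IsPosDom.removeAttr_opp {G : GameGraph V} {P : Player} {S X : Set V}
    (h : G.IsPosDom P S) (hX : Disjoint S X) : (G.removeAttr P.opp X).IsPosDom P S := by
  have hna : ∀ v ∈ S, ¬ G.Attr P.opp X v := fun v hv => h.not_attr hX hv
  obtain ⟨hsub, τ, hτ, hcl, hwin⟩ := h
  refine ⟨fun v hv => ⟨hsub hv, hna v hv⟩, τ, fun v hv hP => ?_, fun v hv w hw => ?_,
    fun ρ hρ hst => hwin ρ hρ fun i => ⟨(hst i).1.1, (hst i).2⟩⟩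
  · exact ⟨hτ v hv hP, hna v hv, hna _ (hcl v hv _ ⟨hτ v hv hP, fun _ => rfl⟩)⟩
  · exact hcl v hv w ⟨hw.1.1, hw.2⟩

/-- A dominion of `P` keeps its winning strategy when an attractor of `P` is removed, since the
nodes of `P` outside the attractor have no moves into it. -/
theorem IsPosDom.removeAttr_self {G : GameGraph V} {P : Player} {S : Set V}
    (h : G.IsPosDom P S) (X : Set V) :
    (G.removeAttr P X).IsPosDom P (S ∩ (G.removeAttr P X).nodes) := by
  obtain ⟨hsub, τ, hτ, hcl, hwin⟩ := h
  refine ⟨Set.inter_subset_right, τ, fun v hv hP => ?_, fun v hv w hw => ?_,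
    fun ρ hρ hst => hwin ρ (fun i => (hρ i).1) fun i => ⟨(hst i).1.1, (hst i).2⟩⟩
  · have he := hτ v hv.1 hP
    exact ⟨he, hv.2.2, fun hA => hv.2.2 (Attr.own v _ hP he hA)⟩
  · exact ⟨hcl v hv.1 w ⟨hw.1.1, hw.2⟩, (G.edge_mem _ _ hw.1.1).2, hw.1.2.2⟩

/-- A dominion of `P` in a subgame that the opponent cannot leave is a dominion in the whole
game. -/
theorem IsPosDom.of_removeAttr_opp {G : GameGraph V} {P : Player} {S X : Set V}
    (h : (G.removeAttr P.opp X).IsPosDom P S) : G.IsPosDom P S := by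
  obtain ⟨hsub, τ, hτ, hcl, hwin⟩ := h
  have key : ∀ v ∈ S, ∀ w, G.Step P τ v w → (G.removeAttr P.opp X).Step P τ v w := by
    rintro v hv w ⟨he, hw⟩
    refine ⟨?_, hw⟩
    by_cases hP : G.owner v = P
    · rw [hw hP]; exact hτ v hv hP
    · exact ⟨he, (hsub hv).2,
        fun hA => (hsub hv).2 (Attr.own v w (Player.ne_iff_eq_opp.1 hP) he hA)⟩
  exact ⟨fun v hv => (hsub hv).1, τ, fun v hv hP => (hτ v hv hP).1,
    fun v hv w hw => hcl v hv w (key v hv w hw),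
    fun ρ hρ hst => hwin ρ hρ fun i => key _ (hρ i) _ (hst i)⟩

/-! ### Dominions without the top priority -/

/-- If a set closed under `r` has no dead ends, and a node satisfying `Q` is reachable from
everywhere in it, then some infinite `r`-path visits `Q` infinitely often. -/
theorem exists_path_frequently {α : Type*} {r : α → α → Prop} {S : Set α} {Q : α → Prop}
    (hcl : ∀ v ∈ S, ∀ w, r v w → w ∈ S) (hser : ∀ v ∈ S, ∃ w, r v w)
    (hreach : ∀ v ∈ S, ∃ w, Relation.ReflTransGen r v w ∧ Q w) {v : α} (hv : v ∈ S) :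
    ∃ ρ : ℕ → α, (∀ i, ρ i ∈ S) ∧ (∀ i, r (ρ i) (ρ (i + 1))) ∧
      ∃ᶠ i in Filter.atTop, Q (ρ i) := by
  -- `R n v`: the set `Q` can be reached from `v` in exactly `n` moves
  let R : ℕ → α → Prop := fun n =>
    Nat.rec (motive := fun _ => α → Prop) Q (fun _ A v => ∃ w, r v w ∧ A w) n
  have hR : ∀ v ∈ S, ∃ n, R n v := by
    intro v hv
    obtain ⟨w, hvw, hw⟩ := hreach v hv
    clear hv
    induction hvw using Relation.ReflTransGen.head_induction_on with
    | refl => exact ⟨0, hw⟩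
    | head h _ ih =>
      obtain ⟨n, hn⟩ := ih
      exact ⟨n + 1, _, h, hn⟩
  have hd : ∀ v, ∃ d, v ∈ S → R d v ∧ ∀ n, R n v → d ≤ n := by
    intro v
    by_cases hv : v ∈ S
    · obtain ⟨n, hn, hmin⟩ := wellFounded_lt.has_min {n | R n v} (hR v hv)
      exact ⟨n, fun _ => ⟨hn, fun m hm => not_lt.1 (hmin m hm)⟩⟩
    · exact ⟨0, fun h => (hv h).elim⟩
  choose d hd using hd
  -- moving along shortest paths, `Q` is met again and again
  have hnext : ∀ v, ∃ w, v ∈ S → r v w ∧ (¬ Q v → d w < d v) := by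
    intro v
    by_cases hv : v ∈ S
    · by_cases hQ : Q v
      · obtain ⟨w, hw⟩ := hser v hv
        exact ⟨w, fun _ => ⟨hw, fun h => (h hQ).elim⟩⟩
      · have hspec := (hd v hv).1
        cases hz : d v with
        | zero => rw [hz] at hspec; exact (hQ hspec).elim
        | succ m =>
          rw [hz] at hspec
          obtain ⟨w, hw, hRw⟩ := hspec
          exact ⟨w, fun _ => ⟨hw, fun _ =>
            Nat.lt_succ_of_le ((hd w (hcl v hv w hw)).2 m hRw)⟩⟩
    · exact ⟨v, fun h => (hv h).elim⟩
  choose f hf using hnext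
  have hmem : ∀ i, f^[i] v ∈ S := by
    intro i
    induction i with
    | zero => exact hv
    | succ i ih => rw [Function.iterate_succ_apply']; exact hcl _ ih _ (hf _ ih).1
  refine ⟨fun i => f^[i] v, hmem, fun i => ?_, ?_⟩
  · simp only [Function.iterate_succ_apply']
    exact (hf _ (hmem i)).1
  · rw [Filter.frequently_atTop]
    by_contra! hcon
    obtain ⟨a, ha⟩ := hcon
    have hdec : ∀ i, d (f^[a + i] v) + i ≤ d (f^[a] v) := by
      intro i
      induction i with
      | zero => simp
      | succ i ih =>
        have := (hf _ (hmem (a + i))).2 (ha (a + i) (by omega))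
        rw [← Function.iterate_succ_apply' f] at this
        rw [← Nat.add_assoc a i 1]
        change d (f^[a + i + 1] v) < _ at this
        omega
    have := hdec (d (f^[a] v) + 1)
    omega

/-- If `P` likes the top priority `h`, then a nonempty dominion of the opponent contains a nonempty
dominion of the opponent without nodes of priority `h`: the nodes from which no node of priority
`h` is reachable under the opponent's strategy. -/
theorem IsPosDom.exists_subset_avoiding {G : GameGraph V} {P : Player} {h : ℕ} (hP : P.Likes h)
    (hub : ∀ v ∈ G.nodes, G.prio v ≤ h) {S : Set V} (hS : G.IsPosDom P.opp S)
    (hne : S.Nonempty) :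
    ∃ S' ⊆ S, S'.Nonempty ∧ G.IsPosDom P.opp S' ∧ Disjoint S' (G.prioNodes h) := by
  obtain ⟨hsub, τ, hτ, hcl, hwin⟩ := hS
  let S' := {v | v ∈ S ∧ ∀ w, Relation.ReflTransGen (G.Step P.opp τ) v w → G.prio w ≠ h}
  refine ⟨S', fun v hv => hv.1, ?_, ⟨fun v hv => hsub hv.1, τ, fun v hv => hτ v hv.1,
    fun v hv w hw => ⟨hcl v hv.1 w hw, fun u hu => hv.2 u (.head hw hu)⟩,
    fun ρ hρ => hwin ρ fun i => (hρ i).1⟩,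
    Set.disjoint_left.2 fun v hv hN => hv.2 v .refl hN.2⟩
  by_contra hemp
  obtain ⟨v, hv⟩ := hne
  obtain ⟨ρ, hρS, hρ, hfreq⟩ := exists_path_frequently (Q := fun v => G.prio v = h) hcl
    (fun v hv => exists_step (hsub hv) (hτ v hv)) (fun v hv => by
      by_contra! hno
      exact hemp ⟨v, hv, fun w hw => hno w hw⟩) hv
  exact G.limsupCond_disjoint
    ⟨h, isGreatest_of_frequently (fun i => hub _ (hsub (hρS i))) hfreq, hP⟩ (hwin ρ hρS hρ)

/-! ### Positional determinacy -/

/-- Attractor strategy: outside `N`, all moves that agree with it stay in the attractor and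
decrease a rank. -/
theorem exists_attr_strategy (G : GameGraph V) (hfin : G.nodes.Finite) (P : Player) (N : Set V) :
    ∃ (τ : V → V) (f : V → ℕ), ∀ v, G.Attr P N v → v ∉ N →
      (G.owner v = P → G.edge v (τ v)) ∧
      ∀ w, G.Step P τ v w → G.Attr P N w ∧ f w < f v := by
  classical
  -- a maximal set `R` of attracted nodes with such a strategy is the whole attractor
  let Q : Set V → Prop := fun R => (∀ v ∈ R, G.Attr P N v) ∧
    ∃ (τ : V → V) (f : V → ℕ), ∀ v ∈ R, v ∉ N →
      (G.owner v = P → G.edge v (τ v)) ∧ ∀ w, G.Step P τ v w → w ∈ R ∧ f w < f v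
  have hQfin : {R | Q R}.Finite :=
    hfin.finite_subsets.subset fun R hR v hv => (hR.1 v hv).mem_nodes
  obtain ⟨R, hR⟩ := hQfin.exists_maximal ⟨∅, by simp, id, 0, by simp⟩
  obtain ⟨hRA, τ, f, hτ⟩ := hR.prop
  -- one more node, all of whose moves under a suitable choice lead to `R`, can be added
  have hadd : ∀ v u, G.Attr P N v → (v ∉ N → (G.owner v = P → G.edge v u) ∧
      ∀ w, G.edge v w → (G.owner v = P → w = u) → w ∈ R) → v ∈ R := by
    intro v u hA hu
    by_contra hvR
    obtain ⟨M, hM⟩ := ((hfin.subset fun v hv => (hRA v hv).mem_nodes).image f).bddAbove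
    refine hvR (hR.le_of_ge (y := insert v R) ⟨?_, Function.update τ v u,
      Function.update f v (M + 1), ?_⟩ (Set.subset_insert v R) (Set.mem_insert v R))
    · rintro x (rfl | hx)
      exacts [hA, hRA x hx]
    · intro x hx hxN
      by_cases hxv : x = v
      · subst hxv
        refine ⟨fun hP => by simpa using (hu hxN).1 hP, fun w hw => ?_⟩
        have hwR : w ∈ R := (hu hxN).2 w hw.1 fun hP => by simpa using hw.2 hP
        have hne : w ≠ x := fun h => hvR (h ▸ hwR)
        have := hM ⟨w, hwR, rfl⟩
        exact ⟨Or.inr hwR, by simp [hne]; omega⟩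
      · obtain ⟨h₁, h₂⟩ := hτ x (hx.resolve_left hxv) hxN
        refine ⟨fun hP => by simpa [hxv] using h₁ hP, fun w hw => ?_⟩
        obtain ⟨hwR, hlt⟩ := h₂ w ⟨hw.1, fun hP => by simpa [hxv] using hw.2 hP⟩
        have hne : w ≠ v := fun h => hvR (h ▸ hwR)
        exact ⟨Or.inr hwR, by simpa [hne, hxv] using hlt⟩
  have hall : ∀ v, G.Attr P N v → v ∈ R := by
    intro v hv
    induction hv with
    | base v hv hN => exact hadd v v (.base v hv hN) fun h => (h hN).elim
    | own v w hP he hw ih =>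
      exact hadd v w (.own v w hP he hw) fun _ => ⟨fun _ => he, fun x _ hx => hx hP ▸ ih⟩
    | opp v hv hP hall ih =>
      exact hadd v v (.opp v hv hP hall) fun _ => ⟨fun h => (hP h).elim, fun x hx _ => ih x hx⟩
  exact ⟨τ, f, fun v hv hN => ⟨(hτ v (hall v hv) hN).1, fun w hw =>
    ⟨hRA w ((hτ v (hall v hv) hN).2 w hw).1, ((hτ v (hall v hv) hN).2 w hw).2⟩⟩⟩

/-- If `P` likes the top priority `h` and wins everywhere outside the attractor of the nodes of
priority `h`, then `P` wins everywhere. -/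
theorem isPosDom_nodes_of_removeAttr {G : GameGraph V} (hfin : G.nodes.Finite) {P : Player} {h : ℕ}
    (hP : P.Likes h) (hub : ∀ v ∈ G.nodes, G.prio v ≤ h)
    (hH : (G.removeAttr P (G.prioNodes h)).IsPosDom P (G.removeAttr P (G.prioNodes h)).nodes) :
    G.IsPosDom P G.nodes := by
  obtain ⟨-, τH, hHe, -, hHw⟩ := hH
  obtain ⟨τA, f, hA⟩ := G.exists_attr_strategy hfin P (G.prioNodes h)
  set N := G.prioNodes h
  have hex : ∀ v, ∃ u, (G.Attr P N v → v ∉ N → u = τA v) ∧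
      (v ∈ G.nodes → ¬ G.Attr P N v → u = τH v) ∧
      (v ∈ G.nodes → G.owner v = P → G.edge v u) := by
    intro v
    by_cases hv : v ∈ G.nodes
    · by_cases hAv : G.Attr P N v
      · by_cases hN : v ∈ N
        · obtain ⟨u, hu⟩ := G.exists_succ v hv
          exact ⟨u, fun _ h => (h hN).elim, fun _ h => (h hAv).elim, fun _ _ => hu⟩
        · exact ⟨τA v, fun _ _ => rfl, fun _ h => (h hAv).elim, fun _ => (hA v hAv hN).1⟩
      · exact ⟨τH v, fun h => (hAv h).elim, fun _ _ => rfl, fun _ hv' => (hHe v ⟨hv, hAv⟩ hv').1⟩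
    · exact ⟨v, fun h => (hv h.mem_nodes).elim, fun h => (hv h).elim, fun h => (hv h).elim⟩
  choose τ hτA hτH hτe using hex
  refine ⟨subset_rfl, τ, hτe, fun v _ w hw => (G.edge_mem _ _ hw.1).2, fun ρ hρ hst => ?_⟩
  by_cases hfreq : ∃ᶠ i in Filter.atTop, G.prio (ρ i) = h
  · exact ⟨h, isGreatest_of_frequently (fun i => hub _ (hρ i)) hfreq, hP⟩
  · obtain ⟨k, hk⟩ := Filter.eventually_atTop.1 (Filter.not_frequently.1 hfreq)
    have hkN : ∀ i, ρ (i + k) ∉ N := fun i hi => hk _ (by omega) hi.2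
    -- after the last visit to `N`, the attractor is not entered any more
    have hnA : ∀ m, ¬ G.Attr P N (ρ (m + k)) := by
      intro m hm
      have hdec : ∀ i, G.Attr P N (ρ (m + i + k)) ∧ f (ρ (m + i + k)) + i ≤ f (ρ (m + k)) := by
        intro i
        induction i with
        | zero => exact ⟨hm, le_rfl⟩
        | succ i ih =>
          have hs := hst (m + i + k)
          have := (hA _ ih.1 (hkN _)).2 _ ⟨hs.1, fun h => (hs.2 h).trans (hτA _ ih.1 (hkN _))⟩
          rw [show m + i + k + 1 = m + (i + 1) + k by omega] at this
          exact ⟨this.1, by omega⟩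
      have := (hdec (f (ρ (m + k)) + 1)).2
      omega
    refine limsupCond_of_tail k (hHw _ (fun i => ⟨hρ _, hnA i⟩) fun i => ?_)
    have hs := hst (i + k)
    rw [show i + k + 1 = i + 1 + k by omega] at hs
    exact ⟨⟨hs.1, hnA i, hnA (i + 1)⟩, fun h => (hs.2 h).trans (hτH _ (hρ _) (hnA i))⟩

/-- A maximal positional dominion contains its attractor. -/
theorem attr_subset_of_maximal {G : GameGraph V} {P : Player} {S : Set V}
    (hS : Maximal (G.IsPosDom P) S) {v : V} (hv : G.Attr P S v) : v ∈ S := by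
  have hadd : ∀ v u, v ∈ G.nodes → (G.owner v = P → G.edge v u) →
      (∀ w, G.edge v w → (G.owner v = P → w = u) → w ∈ S) → v ∈ S := by
    intro v u hv he hS'
    refine hS.le_of_ge (y := S ∪ {v}) (hS.prop.union (by simpa using hv) (fun _ => u) ?_ ?_ ?_)
      Set.subset_union_left (Or.inr rfl)
    · rintro _ rfl _ hP
      exact he hP
    · rintro _ rfl _ w hw
      exact Or.inl (hS' w hw.1 hw.2)
    · intro ρ hρ hst
      have h := (hst 0).1
      rw [(hρ 0).1, (hρ 1).1] at h
      exact (G.no_loop v h).elim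
  induction hv with
  | base _ _ hN => exact hN
  | own v w hP he _ ih =>
    exact hadd v w (G.edge_mem _ _ he).1 (fun _ => he) fun x _ hx => hx hP ▸ ih
  | opp v hv hP _ ih => exact hadd v v hv (fun h => (hP h).elim) fun x hx _ => ih x hx

/-- A maximal positional dominion leaves a game in which its player has no positional dominion. -/
theorem eq_empty_of_maximal {G : GameGraph V} {P : Player} {S T : Set V}
    (hS : Maximal (G.IsPosDom P) S) (hT : (G.removeAttr P S).IsPosDom P T) : T = ∅ := by
  obtain ⟨hsub, τ, hτ, hcl, hwin⟩ := hT
  have hna : ∀ {v}, v ∉ S → ¬ G.Attr P S v := fun hv h => hv (attr_subset_of_maximal hS h)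
  have hU : G.IsPosDom P (S ∪ T) := by
    refine hS.prop.union (fun v hv => (hsub hv).1) τ (fun v hv _ hP => (hτ v hv hP).1) ?_ ?_
    · intro v hv hvS w hw
      by_cases hwS : w ∈ S
      · exact Or.inl hwS
      · exact Or.inr (hcl v hv w ⟨⟨hw.1, hna hvS, hna hwS⟩, hw.2⟩)
    · exact fun ρ hρ hst => hwin ρ (fun i => (hρ i).1) fun i =>
        ⟨⟨(hst i).1, hna (hρ i).2, hna (hρ (i + 1)).2⟩, (hst i).2⟩
  refine Set.eq_empty_of_forall_notMem fun v hv => (hsub hv).2 ?_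
  exact .base v (hsub hv).1 (hS.le_of_ge hU Set.subset_union_left (Or.inr hv))

theorem prio_le_of_removeAttr_prioNodes {G : GameGraph V} {P : Player} {h : ℕ}
    (hub : ∀ v ∈ G.nodes, G.prio v ≤ h + 1) :
    ∀ v ∈ (G.removeAttr P (G.prioNodes (h + 1))).nodes,
      (G.removeAttr P (G.prioNodes (h + 1))).prio v ≤ h := fun v hv =>
  Nat.le_of_lt_succ (lt_of_le_of_ne (hub v hv.1) fun he => hv.2 (.base v hv.1 ⟨hv.1, he⟩))

theorem nodes_eq_empty_of_prio_le_zero {G : GameGraph V} (hub : ∀ v ∈ G.nodes, G.prio v ≤ 0) :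
    G.nodes = ∅ :=
  Set.eq_empty_of_forall_notMem fun v hv => (G.prio_pos v hv).not_ge (hub v hv)

/-- Positional determinacy of finite parity games. -/
theorem exists_isPosDom_union (h : ℕ) {P : Player} (hP : P.Likes h) (G : GameGraph V)
    (hfin : G.nodes.Finite) (hub : ∀ v ∈ G.nodes, G.prio v ≤ h) :
    ∃ S T, G.IsPosDom P S ∧ G.IsPosDom P.opp T ∧ S ∪ T = G.nodes := by
  induction h generalizing P G with
  | zero =>
    exact ⟨∅, ∅, G.isPosDom_empty _, G.isPosDom_empty _, by
      simp [nodes_eq_empty_of_prio_le_zero hub]⟩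
  | succ h ih =>
    obtain ⟨T, hT⟩ := Set.Finite.exists_maximal (s := {T | G.IsPosDom P.opp T})
      (hfin.finite_subsets.subset fun T hT => hT.1) ⟨∅, G.isPosDom_empty _⟩
    change Maximal (G.IsPosDom P.opp) T at hT
    set G' := G.removeAttr P.opp T with hG'
    have hfin' : G'.nodes.Finite := hfin.subset fun v hv => hv.1
    have hub' : ∀ v ∈ G'.nodes, G'.prio v ≤ h + 1 := fun v hv => hub v hv.1
    -- the opponent has no dominion in `G'`, hence none in its subgame either
    obtain ⟨A, B, hA, hB, hAB⟩ := ih hP.pred (G'.removeAttr P (G'.prioNodes (h + 1)))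
      (hfin'.subset fun v hv => hv.1) (prio_le_of_removeAttr_prioNodes hub')
    rw [P.opp_opp] at hB
    have hA' : A = ∅ := by
      refine eq_empty_of_maximal hT (IsPosDom.of_removeAttr_opp (X := G'.prioNodes (h + 1)) ?_)
      rwa [P.opp_opp]
    rw [hA', Set.empty_union] at hAB
    have hall := isPosDom_nodes_of_removeAttr hfin' hP hub' (hAB ▸ hB)
    refine ⟨G'.nodes, T, hall.of_removeAttr_opp, hT.prop, ?_⟩
    refine Set.Subset.antisymm (Set.union_subset (fun v hv => hv.1) hT.prop.1) fun v hv => ?_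
    by_cases hvT : v ∈ T
    · exact Or.inr hvT
    · exact Or.inl ⟨hv, fun hA => hvT (attr_subset_of_maximal hT hA)⟩

/-! ### Winning regions -/

/-- Two strategies of opposite players have a common play. -/
theorem exists_play (G : GameGraph V) {σ τ : List V → V} {P : Player} (hσ : G.IsStrategy P σ)
    (hτ : G.IsStrategy P.opp τ) {v : V} (hv : v ∈ G.nodes) :
    ∃ ρ : ℕ → V, G.IsPlay ρ ∧ ρ 0 = v ∧ G.Agrees P σ ρ ∧ G.Agrees P.opp τ ρ := by
  classical
  let next : List V × V → V := fun s => if G.owner s.2 = P then σ s.1 else τ s.1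
  -- the history and its last node
  let s : ℕ → List V × V := fun n =>
    Nat.rec ([v], v) (fun _ s => (s.1 ++ [next s], next s)) n
  have hs : ∀ n, (s n).1 = (List.range (n + 1)).map fun i => (s i).2 := by
    intro n
    induction n with
    | zero => rfl
    | succ n ih =>
      rw [List.range_succ, List.map_append, ← ih]
      rfl
  have hlast : ∀ n, (s n).1.getLast? = some (s n).2 := by
    intro n
    rw [hs, List.range_succ]
    simp
  have hedge : ∀ n, G.IsPartialPlay (s n).1 → G.edge (s n).2 (next (s n)) := by
    intro n hn
    by_cases hP : G.owner (s n).2 = P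
    · simpa only [next, if_pos hP] using hσ _ _ hn (hlast n) hP
    · simpa only [next, if_neg hP] using hτ _ _ hn (hlast n) (Player.ne_iff_eq_opp.1 hP)
  have hpart : ∀ n, G.IsPartialPlay (s n).1 := by
    intro n
    induction n with
    | zero => exact ⟨by simp [s], by simpa [s] using hv, by simp [s]⟩
    | succ n ih =>
      have he := hedge n ih
      change G.IsPartialPlay ((s n).1 ++ [next (s n)])
      refine ⟨by simp, fun u hu => ?_, List.isChain_append.2 ⟨ih.2.2, by simp, ?_⟩⟩
      · rcases List.mem_append.1 hu with hu | hu
        · exact ih.2.1 u hu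
        · rw [List.mem_singleton.1 hu]; exact (G.edge_mem _ _ he).2
      · intro x hx y hy
        rw [hlast] at hx
        simp only [Option.mem_def, Option.some.injEq, List.head?_cons] at hx hy
        rw [← hx, ← hy]
        exact he
  refine ⟨fun i => (s i).2, fun i => hedge i (hpart i), rfl, fun i hi => ?_, fun i hi => ?_⟩
  · rw [← hs]; exact if_pos hi
  · rw [← hs]; exact if_neg (Player.ne_iff_eq_opp.2 hi)

theorem disjoint_win (G : GameGraph V) (P : Player) : Disjoint (G.win P) (G.win P.opp) := by
  rw [Set.disjoint_left]
  rintro v ⟨hv, σ, hσ, hσw⟩ ⟨-, τ, hτ, hτw⟩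
  obtain ⟨ρ, hρ, h0, h₁, h₂⟩ := G.exists_play hσ hτ hv
  exact G.limsupCond_disjoint (hσw ρ hρ h0 h₁) (hτw ρ hρ h0 h₂)

theorem IsPosDom.subset_win {G : GameGraph V} {P : Player} {S : Set V} (h : G.IsPosDom P S) :
    S ⊆ G.win P := fun v hv => by
  obtain ⟨hn, σ, hσ, hw⟩ := h.isDominion.2 v hv
  exact ⟨hn, σ, hσ, fun ρ h₁ h₂ h₃ => (hw ρ h₁ h₂ h₃).1⟩

/-- The winning regions are positional dominions and cover the nodes. -/
theorem isPosDom_win (G : GameGraph V) (hfin : G.nodes.Finite) {P : Player} {h : ℕ}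
    (hP : P.Likes h) (hub : ∀ v ∈ G.nodes, G.prio v ≤ h) :
    G.IsPosDom P (G.win P) ∧ G.IsPosDom P.opp (G.win P.opp) ∧
      G.win P ∪ G.win P.opp = G.nodes := by
  obtain ⟨S, T, hS, hT, hST⟩ := exists_isPosDom_union h hP G hfin hub
  have hd := Set.disjoint_left.1 (G.disjoint_win P)
  have hSw : S = G.win P := hS.subset_win.antisymm fun v hv =>
    (hST.symm ▸ hv.1 : v ∈ S ∪ T).resolve_right fun h => hd hv (hT.subset_win h)
  have hTw : T = G.win P.opp := hT.subset_win.antisymm fun v hv =>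
    (hST.symm ▸ hv.1 : v ∈ S ∪ T).resolve_left fun h => hd (hS.subset_win h) hv
  exact ⟨hSw ▸ hS, hTw ▸ hT, hSw ▸ hTw ▸ hST⟩

/-! ### The recursive procedure -/

/-- What a call with precision `p` for `P` and `q` for the opponent guarantees about its result
`W`: it contains all dominions of `P` with at most `p` nodes and is disjoint from all dominions of
the opponent with at most `q` nodes. -/
structure Approximates (G : GameGraph V) (P : Player) (p q : ℕ) (W : Set V) : Prop where
  subset_nodes : W ⊆ G.nodes
  subset_of_isPosDom : ∀ S, G.IsPosDom P S → S.ncard ≤ p → S ⊆ W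
  disjoint_of_isPosDom : ∀ S, G.IsPosDom P.opp S → S.ncard ≤ q → Disjoint S W

/-- The game graphs on which a procedure with priority bound `h` is called. -/
structure Bounded (G : GameGraph V) (h : ℕ) : Prop where
  finite : G.nodes.Finite
  prio_le : ∀ v ∈ G.nodes, G.prio v ≤ h

theorem Bounded.removeAttr {G : GameGraph V} {h : ℕ} (hG : G.Bounded h) (P : Player) (N : Set V) :
    (G.removeAttr P N).Bounded h :=
  ⟨hG.finite.subset fun _ hv => hv.1, fun v hv => hG.prio_le v hv.1⟩

theorem Bounded.removeAttr_prioNodes {G : GameGraph V} {h : ℕ} (hG : G.Bounded (h + 1))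
    (P : Player) : (G.removeAttr P (G.prioNodes (h + 1))).Bounded h :=
  ⟨(hG.removeAttr P _).finite, prio_le_of_removeAttr_prioNodes hG.prio_le⟩

theorem approximates_empty {G : GameGraph V} (hfin : G.nodes.Finite) {P : Player} {p q : ℕ}
    (h : G.nodes = ∅ ∨ p ≤ 1) : G.Approximates P p q ∅ := by
  refine ⟨Set.empty_subset _, fun S hS hp => ?_, fun S _ _ => Set.disjoint_empty S⟩
  rcases h with h | h
  · exact h ▸ hS.1
  · exact (hS.eq_empty_of_ncard_le_one hfin (hp.trans h)).le

section Block

variable {P : Player} {h r p : ℕ} {call : GameGraph V → Set V → Prop} {G G' : GameGraph V}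
  {W : Set V}

/-- Dominions of `P` with at most `p` nodes survive a block. -/
theorem Block.isPosDom_self
    (hcall : ∀ H U, H.Bounded h → call H U → H.Approximates P.opp r p U)
    (hG : G.Bounded (h + 1)) (hB : Block P (h + 1) call G W G') {S : Set V}
    (hS : G.IsPosDom P S) (hp : S.ncard ≤ p) : G'.IsPosDom P S := by
  obtain ⟨hc, rfl⟩ := hB
  have hW := hcall _ _ (hG.removeAttr_prioNodes P) hc
  refine hS.removeAttr_opp (Set.disjoint_left.2 fun v hv hvW => ?_)
  -- what remains of `S` in the recursive call is a dominion of `P` there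
  have hd := hW.disjoint_of_isPosDom (S ∩ (G.removeAttr P (G.prioNodes (h + 1))).nodes)
    (by simpa only [P.opp_opp] using hS.removeAttr_self (G.prioNodes (h + 1)))
    ((Set.ncard_le_ncard Set.inter_subset_left (hG.finite.subset hS.1)).trans hp)
  exact Set.disjoint_left.1 hd ⟨hv, hW.subset_nodes hvW⟩ hvW

theorem Block.bounded (hG : G.Bounded (h + 1)) (hB : Block P (h + 1) call G W G') :
    G'.Bounded (h + 1) := by
  obtain ⟨-, rfl⟩ := hB
  exact hG.removeAttr _ _

theorem Block.nodes_subset (hB : Block P (h + 1) call G W G') : G'.nodes ⊆ G.nodes := by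
  obtain ⟨-, rfl⟩ := hB
  exact fun v hv => hv.1

/-- What a block leaves of a dominion of the opponent is a dominion again, because an attractor of
the opponent is removed. -/
theorem Block.isPosDom_opp (hB : Block P (h + 1) call G W G') {S : Set V}
    (hS : G.IsPosDom P.opp (S ∩ G.nodes)) : G'.IsPosDom P.opp (S ∩ G'.nodes) := by
  have hsub := hB.nodes_subset
  obtain ⟨-, rfl⟩ := hB
  have := hS.removeAttr_self W
  rwa [Set.inter_assoc, Set.inter_eq_self_of_subset_right hsub] at this

/-- A block removes the dominions of the opponent with at most `r` nodes that avoid the top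
priority. -/
theorem Block.subset_of_isPosDom_opp
    (hcall : ∀ H U, H.Bounded h → call H U → H.Approximates P.opp r p U)
    (hG : G.Bounded (h + 1)) (hB : Block P (h + 1) call G W G') {S : Set V}
    (hS : G.IsPosDom P.opp S) (hN : Disjoint S (G.prioNodes (h + 1))) (hr : S.ncard ≤ r) :
    S ⊆ W := by
  refine (hcall _ _ (hG.removeAttr_prioNodes P) hB.1).subset_of_isPosDom S ?_ hr
  simpa [P.opp_opp] using IsPosDom.removeAttr_opp hS hN

theorem Block.disjoint_nodes
    (hcall : ∀ H U, H.Bounded h → call H U → H.Approximates P.opp r p U)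
    (hG : G.Bounded (h + 1)) (hB : Block P (h + 1) call G W G') : Disjoint W G'.nodes := by
  have hW := (hcall _ _ (hG.removeAttr_prioNodes P) hB.1).subset_nodes
  obtain ⟨-, rfl⟩ := hB
  exact Set.disjoint_left.2 fun v hv hv' => hv'.2 (.base v hv'.1 hv)

/-- If a block finds nothing, then all nonempty dominions of the opponent have more than `r`
nodes. -/
theorem Block.eq_empty_of_isPosDom_opp (hP : P.Likes (h + 1))
    (hcall : ∀ H U, H.Bounded h → call H U → H.Approximates P.opp r p U)
    (hG : G.Bounded (h + 1)) (hB : Block P (h + 1) call G ∅ G') {S : Set V}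
    (hS : G.IsPosDom P.opp S) (hr : S.ncard ≤ r) : S = ∅ := by
  by_contra hne
  obtain ⟨S', hsub, hne', hS', hN⟩ :=
    hS.exists_subset_avoiding hP hG.prio_le (Set.nonempty_iff_ne_empty.2 hne)
  have hle := Set.ncard_le_ncard hsub (hG.finite.subset hS.1)
  exact hne'.ne_empty (Set.subset_empty_iff.1
    (hB.subset_of_isPosDom_opp hcall hG hS' hN (hle.trans hr)))

/-- What every block of a loop preserves is preserved by the loop. -/
theorem WhileLoop.preserves {I : GameGraph V → Prop}
    (hI : ∀ G W G', I G → Block P h call G W G' → I G')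
    (hL : WhileLoop P h call W G G') (hG : I G) : I G' := by
  induction hL with
  | done _ => exact hG
  | iter W W₁ G G₁ G' _ hB _ ih => exact ih (hI _ _ _ hG hB)

/-- After a loop, a further block would find nothing: the last block of the loop returned `∅`, so
it did not change the game. -/
theorem WhileLoop.block_empty (hL : WhileLoop P h call W G G') (hW : W = ∅ → Block P h call G ∅ G) :
    Block P h call G' ∅ G' := by
  induction hL with
  | done _ => exact hW rfl
  | iter W W₁ G G₁ G' _ hB _ ih =>
    refine ih ?_
    rintro rfl
    have h₁ : G₁ = G := hB.2.trans (G.removeAttr_empty _)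
    rwa [h₁] at hB ⊢

end Block

/-- Correctness of the procedure relative to its precisions. That the dominions of the opponent are
removed rests on halving: after the first loop every nonempty one has more than `q / 2` nodes, so
the block with full precision leaves at most `q / 2` nodes of it for the second loop. -/
theorem SolveReturns.approximates {h : ℕ} {P : Player} (hP : P.Likes h) {G : GameGraph V}
    (hG : G.Bounded h) {p q : ℕ} {W : Set V} (hW : SolveReturns h P G p q W) :
    G.Approximates P p q W := by
  induction h generalizing P G p q W with
  | zero =>
    obtain ⟨hsmall, rfl⟩ := hW
    exact approximates_empty hG.finite hsmall
  | succ h ih =>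
    rcases hW with ⟨hsmall, rfl⟩ | ⟨-, W₁, W₂, G₁, G₂, G₃, G₄, ⟨hB₁, hL₁⟩, hB₂, hL₂, rfl⟩
    · exact approximates_empty hG.finite hsmall
    have hcall : ∀ r H U, H.Bounded h → SolveReturns h P.opp H r p U →
        H.Approximates P.opp r p U := fun r H U hH hU => ih hP.pred hH hU
    -- a property preserved by all blocks holds at all stages
    have hinv : ∀ I : GameGraph V → Prop, I G →
        (∀ r G W G', I G → Block P (h + 1) (fun H U => SolveReturns h P.opp H r p U) G W G' →
          I G') → I G₂ ∧ I G₃ ∧ I G₄ := by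
      intro I h0 hI
      have h₂ := hL₁.preserves (hI _) (hI _ _ _ _ h0 hB₁)
      have h₃ := hI _ _ _ _ h₂ hB₂
      exact ⟨h₂, h₃, hL₂.preserves (hI _) h₃⟩
    obtain ⟨b₂, b₃, b₄⟩ := hinv (fun G => G.Bounded (h + 1)) hG fun r G W G' h hB => hB.bounded h
    refine ⟨(hinv (fun G' => G'.nodes ⊆ G.nodes) subset_rfl
      fun r G' W G'' h hB => hB.nodes_subset.trans h).2.2, fun S hS hp => ?_, fun S hS hq => ?_⟩
    · exact (hinv (fun G => G.Bounded (h + 1) ∧ G.IsPosDom P S) ⟨hG, hS⟩ fun r G W G' h hB =>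
        ⟨hB.bounded h.1, hB.isPosDom_self (hcall r) h.1 h.2 hp⟩).2.2.2.1
    · obtain ⟨d₂, d₃, d₄⟩ := hinv (fun G => G.IsPosDom P.opp (S ∩ G.nodes))
        (by rwa [Set.inter_eq_self_of_subset_left hS.1]) fun r G W G' h hB => hB.isPosDom_opp h
      have hSfin : S.Finite := hG.finite.subset hS.1
      have hsub : G₃.nodes ⊆ G₂.nodes := hB₂.nodes_subset
      have hsub' : G₄.nodes ⊆ G₃.nodes := hL₂.preserves (I := fun G => G.nodes ⊆ G₃.nodes)
        (fun G W G' h hB => hB.nodes_subset.trans h) subset_rfl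
      have hq₂ : (S ∩ G₂.nodes).ncard ≤ q :=
        (Set.ncard_le_ncard Set.inter_subset_left hSfin).trans hq
      rw [Set.disjoint_iff_inter_eq_empty]
      by_cases hne : S ∩ G₂.nodes = ∅
      · exact Set.subset_empty_iff.1 (hne ▸ Set.inter_subset_inter_right S (hsub'.trans hsub))
      -- the first stage leaves only opponent dominions with more than `q / 2` nodes
      have hlast₁ := hL₁.block_empty fun hW => by
        subst hW
        have h₁ : G₁ = G := hB₁.2.trans (G.removeAttr_empty _)
        rwa [h₁] at hB₁ ⊢
      -- one of them is removed by the second stage, so that at most `q / 2` nodes of `S` remain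
      obtain ⟨T, hTS, hTne, hT, hTN⟩ :=
        d₂.exists_subset_avoiding hP b₂.prio_le (Set.nonempty_iff_ne_empty.2 hne)
      have hTfin : T.Finite := hSfin.subset (hTS.trans Set.inter_subset_left)
      have hTW : T ⊆ W₂ := hB₂.subset_of_isPosDom_opp (hcall _) b₂ hT hTN
        ((Set.ncard_le_ncard hTS (hSfin.subset Set.inter_subset_left)).trans hq₂)
      have hbig : q / 2 < T.ncard := by
        by_contra! hle
        exact hTne.ne_empty (hlast₁.eq_empty_of_isPosDom_opp hP (hcall _) b₂ hT hle)
      have hdisj : Disjoint T (S ∩ G₃.nodes) :=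
        (hB₂.disjoint_nodes (hcall _) b₂).mono hTW Set.inter_subset_right
      have hsum : T.ncard + (S ∩ G₃.nodes).ncard ≤ (S ∩ G₂.nodes).ncard := by
        rw [← Set.ncard_union_eq hdisj hTfin (hSfin.subset Set.inter_subset_left)]
        exact Set.ncard_le_ncard (Set.union_subset hTS (Set.inter_subset_inter_right S hsub))
          (hSfin.subset Set.inter_subset_left)
      have hsmall : (S ∩ G₄.nodes).ncard ≤ (S ∩ G₃.nodes).ncard :=
        Set.ncard_le_ncard (Set.inter_subset_inter_right S hsub')
          (hSfin.subset Set.inter_subset_left)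
      -- these are removed by the third stage
      have hlast₂ := hL₂.block_empty fun hW =>
        (hTne.ne_empty (Set.subset_empty_iff.1 (hW ▸ hTW))).elim
      exact hlast₂.eq_empty_of_isPosDom_opp hP (hcall _) b₄ d₄ (by omega)

/-- A loop terminates if its recursive calls do, because every block that finds something removes
nodes. -/
theorem exists_whileLoop {P : Player} {h : ℕ} {call : GameGraph V → Set V → Prop}
    (hcall : ∀ H : GameGraph V, H.Bounded h → ∃ U ⊆ H.nodes, call H U) {G : GameGraph V}
    (hG : G.Bounded (h + 1)) :
    ∃ W₁ G₁ G₂, Block P (h + 1) call G W₁ G₁ ∧ WhileLoop P (h + 1) call W₁ G₁ G₂ := by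
  induction hn : G.nodes.ncard using Nat.strong_induction_on generalizing G with
  | _ n ih =>
    obtain ⟨U, hU, hc⟩ := hcall _ (hG.removeAttr_prioNodes P)
    by_cases hne : U = ∅
    · subst hne
      exact ⟨∅, _, _, ⟨hc, rfl⟩, .done _⟩
    · obtain ⟨v, hv⟩ := Set.nonempty_iff_ne_empty.2 hne
      have hlt : (G.removeAttr P.opp U).nodes.ncard < n := by
        rw [← hn]
        refine Set.ncard_lt_ncard ⟨fun x hx => hx.1, fun hsub => ?_⟩ hG.finite
        exact (hsub (hU hv).1).2 (.base v (hU hv).1 hv)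
      obtain ⟨W₁, G₁, G₂, hB, hL⟩ := ih _ hlt (hG.removeAttr P.opp U) rfl
      exact ⟨U, _, G₂, ⟨hc, rfl⟩, .iter _ _ _ _ _ hne hB hL⟩

theorem exists_solveReturns {h : ℕ} {P : Player} (hP : P.Likes h) {G : GameGraph V}
    (hG : G.Bounded h) (p q : ℕ) : ∃ W, SolveReturns h P G p q W := by
  induction h generalizing P G p q with
  | zero => exact ⟨∅, Or.inl (nodes_eq_empty_of_prio_le_zero hG.prio_le), rfl⟩
  | succ h ih =>
    by_cases hsmall : G.nodes = ∅ ∨ p ≤ 1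
    · exact ⟨∅, Or.inl ⟨hsmall, rfl⟩⟩
    have hcall : ∀ (r : ℕ) (H : GameGraph V), H.Bounded h →
        ∃ U ⊆ H.nodes, SolveReturns h P.opp H r p U := by
      intro r H hH
      obtain ⟨U, hU⟩ := ih hP.pred hH r p
      exact ⟨U, (hU.approximates hP.pred hH).subset_nodes, hU⟩
    obtain ⟨W₁, G₁, G₂, hB₁, hL₁⟩ := exists_whileLoop (P := P) (hcall (q / 2)) hG
    have b₂ : G₂.Bounded (h + 1) :=
      hL₁.preserves (fun G W G' h hB => hB.bounded h) (hB₁.bounded hG)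
    obtain ⟨W₂, -, hc⟩ := hcall q _ (b₂.removeAttr_prioNodes P)
    have b₃ := b₂.removeAttr P.opp W₂
    obtain ⟨G₄, hL₂⟩ : ∃ G₄, WhileLoop P (h + 1)
        (fun H U => SolveReturns h P.opp H (q / 2) p U) W₂ (G₂.removeAttr P.opp W₂) G₄ := by
      by_cases hW : W₂ = ∅
      · subst hW
        exact ⟨_, .done _⟩
      · obtain ⟨W₃, G₃, G₄, hB, hL⟩ := exists_whileLoop (P := P) (hcall (q / 2)) b₃
        exact ⟨G₄, .iter _ _ _ _ _ hW hB hL⟩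
    exact ⟨G₄.nodes, Or.inr ⟨hsmall, W₁, W₂, G₁, G₂, _, G₄, ⟨hB₁, hL₁⟩, ⟨hc, rfl⟩, hL₂, rfl⟩⟩

end GameGraph

theorem mainTheorem2 {V : Type*} (G : GameGraph V) (hfin : G.nodes.Finite)
    (h : ℕ) (heven : Even h) (hub : ∀ v ∈ G.nodes, G.prio v ≤ h) :
    (∀ W : Set V,
      G.SolveReturns h Player.even G.nodes.ncard G.nodes.ncard W ↔ W = G.win Player.even) ∧
    G.IsDominion Player.even (G.win Player.even) ∧
    G.IsDominion Player.odd (G.win Player.odd) ∧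
    Disjoint (G.win Player.even) (G.win Player.odd) ∧
    G.win Player.even ∪ G.win Player.odd = G.nodes := by
  obtain ⟨hE, hO, hEO⟩ := G.isPosDom_win hfin (P := .even) heven hub
  refine ⟨?_, hE.isDominion, hO.isDominion, G.disjoint_win .even, hEO⟩
  have hret : ∀ W, GameGraph.SolveReturns h .even G G.nodes.ncard G.nodes.ncard W →
      W = G.win .even := by
    intro W hW
    have hA := GameGraph.SolveReturns.approximates (P := .even) heven ⟨hfin, hub⟩ hW
    refine Set.Subset.antisymm (fun v hv => ?_)
      (hA.subset_of_isPosDom _ hE (Set.ncard_le_ncard hE.1 hfin))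
    exact (hEO.symm ▸ hA.subset_nodes hv : v ∈ G.win .even ∪ G.win Player.even.opp).resolve_right
      fun h => Set.disjoint_left.1
        (hA.disjoint_of_isPosDom _ hO (Set.ncard_le_ncard hO.1 hfin)) h hv
  obtain ⟨W, hW⟩ := GameGraph.exists_solveReturns (P := .even) heven ⟨hfin, hub⟩
    G.nodes.ncard G.nodes.ncard
  exact fun W' => ⟨hret W', fun h => by rw [h, ← hret W hW]; exact hW⟩
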